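/- Let $\mathbf p=\{p_k;k\ge 1\}$ be a probability distribution on a countably infinite alphabet ($p_k\ge 0$, $\sum_{k\ge1}p_k=1$). For $v\ge 1$ let $$\zeta_v=\sum_{k\ge 1}p_k(1-p_k)^v,\qquad \tau_v=v\,\zeta_v .$$ The quantity $\tau_v$ is called the tail index. For real sequences $f,g$ write $f(v)\asymp g(v)$ if there are constants $c_1,c_2>0$ with $c_1g(v)\le f(v)\le c_2g(v)$ for all sufficiently large $v$. 1. (Power tail) If there are $\lambda>1$, $c>0$ and an integer $k_0\ge 1$ with $p_k=c\,k^{-\lambda}$ for all $k\ge k_0$, then $\tau_v\to\infty$ as $v\to\infty$ and $\tau_v\asymp v^{1/\lambda}$. 2. (Sub-exponential tail) If there are $\lambda>0$, $\alpha\in(0,1)$, $c>0$ and an integer $k_0\ge 1$ with $p_k=c\,e^{-\lambda k^{\alpha}}$ for all $k\ge k_0$, then $\tau_v\to\infty$ as $v\to\infty$ and $\tau_v\asymp(\ln v)^{1/\alpha-1}$. 3. (Near-exponential tail) If there are $\lambda>0$, $\beta>0$, $c>0$ and an integer $k_0\ge 2$ with $p_k=c\,e^{-\lambda k/(\ln k)^{\beta}}$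 for all $k\ge k_0$, then $\tau_v\to\infty$ as $v\to\infty$ and $\tau_v\asymp(\ln\ln v)^{\beta}$. In each case the constants $c_1,c_2$ may depend on $\mathbf p$. -/

import Mathlib

open Filter

/-- `p = {p_k ; k ≥ 1}` is a probability distribution on a countably infinite alphabet,
indexed by the positive integers. -/
def IsProbDist (p : ℕ+ → ℝ) : Prop :=
  (∀ k, 0 ≤ p k) ∧ HasSum p 1

/-- The entropic moment `ζ_v = ∑_{k ≥ 1} p_k (1 - p_k)^v`. The series converges for every
probability distribution `p`, being dominated termwise by `∑ p_k`. -/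
noncomputable def entropicMoment (p : ℕ+ → ℝ) (v : ℕ) : ℝ :=
  ∑' k : ℕ+, p k * (1 - p k) ^ v

/-- The tail index `τ_v = v ζ_v`. -/
noncomputable def tailIndex (p : ℕ+ → ℝ) (v : ℕ) : ℝ :=
  (v : ℝ) * entropicMoment p v

/-- `p_k ∝ f(k)` for `k ≥ k₀`, with a positive constant of proportionality. -/
def TailProportional (p : ℕ+ → ℝ) (f : ℝ → ℝ) (k₀ : ℕ+) : Prop :=
  ∃ c : ℝ, 0 < c ∧ ∀ k : ℕ+, k₀ ≤ k → p k = c * f ((k : ℕ) : ℝ)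

/-- Power tail: `p_k ∝ k^(-lam)` for `k ≥ k₀`, some `k₀ ≥ 1`. -/
def HasPowerTail (p : ℕ+ → ℝ) (lam : ℝ) : Prop :=
  ∃ k₀ : ℕ+, TailProportional p (fun x => 1 / x ^ lam) k₀

/-- Sub-exponential tail: `p_k ∝ exp (-lam k^α)` for `k ≥ k₀`, some `k₀ ≥ 1`. -/
def HasSubexpTail (p : ℕ+ → ℝ) (lam α : ℝ) : Prop :=
  ∃ k₀ : ℕ+, TailProportional p (fun x => Real.exp (-(lam * x ^ α))) k₀

/-- Near-exponential tail: `p_k ∝ exp (-lam k / (ln k)^β)` for `k ≥ k₀`, some `k₀ ≥ 2`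
(the expression is undefined at `k = 1`, where `ln k = 0`; increasing `k₀` only weakens the
condition, so nothing is lost). -/
def HasNearExpTail (p : ℕ+ → ℝ) (lam β : ℝ) : Prop :=
  ∃ k₀ : ℕ+, 2 ≤ k₀ ∧
    TailProportional p (fun x => Real.exp (-(lam * x / Real.log x ^ β))) k₀

/-- `f ≍ g`: there are positive constants with `c₁ g(n) ≤ f(n) ≤ c₂ g(n)` for all
sufficiently large `n`. -/
def SameRate (f g : ℕ → ℝ) : Prop :=
  ∃ c₁ c₂ : ℝ, 0 < c₁ ∧ 0 < c₂ ∧ ∀ᶠ n in atTop, c₁ * g n ≤ f n ∧ f n ≤ c₂ * g n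

/-! Write `p_k = c e^{-G(k)}` on the tail and `Y = log v`, so that `v p_k = c e^{-(G(k) - Y)}`. The
term `v p_k (1 - p_k)^v` is `O(e^{-|G(k) - Y|})`, and it is bounded below while `G(k) - Y` stays in
a suitable bounded window. Hence `τ_v` has the order of the number of `k` with `G(k) = Y + O(1)`,
which is `1/G'` at the point where `G = Y`. For the three tails `1/G'` is of order `x`, `x^(1-α)`
and `(log x)^β`, that is `e^{Y/λ}`, `Y^(1/α-1)` and `(log Y)^β` in terms of `Y = G(x)`.

`tailIndex_sameRate` carries this out for general `G`: `sum_exp_neg_abs_le` gives the upper bound,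
`exists_window_card_ge` the lower one. -/

/-! ### Elementary inequalities -/

theorem one_add_rpow_le_exp (s δ : ℝ) (hδ : 0 < δ) :
    ∃ C : ℝ, 0 < C ∧ ∀ x : ℝ, 0 ≤ x → (1 + x) ^ s ≤ C * Real.exp (δ * x) := by
  have h : Tendsto (fun x : ℝ => x ^ s * Real.exp (-δ * x)) atTop (nhds 0) :=
    tendsto_rpow_mul_exp_neg_mul_atTop_nhds_zero s δ hδ
  obtain ⟨X, hX⟩ := eventually_atTop.1 (h.eventually (gt_mem_nhds one_pos))
  have hc : ContinuousOn (fun x : ℝ => x ^ s * Real.exp (-δ * x)) (Set.Icc 1 (max X 1)) := by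
    refine ContinuousOn.mul ?_ (by fun_prop)
    exact continuousOn_id.rpow_const fun x hx => Or.inl (by simp at hx ⊢; linarith [hx.1])
  obtain ⟨M, hM⟩ := (isCompact_Icc.image_of_continuousOn hc).bddAbove
  have hb : ∀ y : ℝ, 1 ≤ y → y ^ s * Real.exp (-δ * y) ≤ max M 1 := by
    intro y hy
    by_cases hyX : X ≤ y
    · exact (hX y hyX).le.trans (le_max_right _ _)
    · exact (hM ⟨y, ⟨hy, (not_le.1 hyX).le.trans (le_max_left _ _)⟩, rfl⟩).trans (le_max_left _ _)
  refine ⟨max M 1 * Real.exp δ, by positivity, fun x hx => ?_⟩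
  have h1 := hb (1 + x) (by linarith)
  have h2 : (1 + x) ^ s = (1 + x) ^ s * Real.exp (-δ * (1 + x)) * Real.exp (δ * (1 + x)) := by
    rw [mul_assoc, ← Real.exp_add]; simp
  rw [h2, mul_assoc (max M 1), ← Real.exp_add, show δ + δ * x = δ * (1 + x) by ring]
  gcongr

/-- Mean value theorem; moving the base point by at most `D` changes `1 + a²` by a bounded factor.
-/
theorem sub_div_le_arctan_sub {a b D : ℝ} (hab : a ≤ b) (hD : b ≤ a + D) :
    (b - a) / (1 + a ^ 2) ≤ (2 + 2 * D ^ 2) * (Real.arctan b - Real.arctan a) := by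
  rcases hab.eq_or_lt with rfl | hlt
  · simp
  obtain ⟨ξ, hξ, h⟩ := exists_hasDerivAt_eq_slope Real.arctan (fun x => 1 / (1 + x ^ 2)) hlt
    Real.continuous_arctan.continuousOn (fun x _ => Real.hasDerivAt_arctan x)
  have hba : 0 < b - a := sub_pos.2 hlt
  rw [eq_div_iff hba.ne'] at h
  rw [← h, div_mul_eq_mul_div, one_mul, mul_div_assoc', div_le_div_iff₀ (by positivity) (by positivity)]
  have h1 : 1 + ξ ^ 2 ≤ (2 + 2 * D ^ 2) * (1 + a ^ 2) := by
    nlinarith [sq_nonneg (a - (ξ - a)), mul_self_le_mul_self (sub_nonneg.2 hξ.1.le)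
      (show ξ - a ≤ D by linarith [hξ.2]), sq_nonneg (D * a)]
  nlinarith [mul_le_mul_of_nonneg_left h1 hba.le]

theorem mul_one_sub_pow_le {q : ℝ} (h1 : q ≤ 1) (v : ℕ) :
    (1 - q) ^ v ≤ Real.exp (-(v * q)) := by
  have := pow_le_pow_left₀ (sub_nonneg.2 h1) (Real.one_sub_le_exp_neg q) v
  rwa [← Real.exp_nat_mul, mul_neg] at this

theorem mul_exp_neg_le_div {x : ℝ} (hx : 0 < x) : x * Real.exp (-x) ≤ 2 / x := by
  have h := Real.quadratic_le_exp_of_nonneg hx.le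
  rw [Real.exp_neg, ← div_eq_mul_inv, div_le_div_iff₀ (Real.exp_pos _) hx]
  nlinarith

theorem mul_exp_neg_le_one {x : ℝ} : x * Real.exp (-x) ≤ 1 := by
  rw [Real.exp_neg, ← div_eq_mul_inv, div_le_one (Real.exp_pos _)]
  linarith [Real.add_one_le_exp x]

theorem increment_bounds {g g' : ℝ → ℝ} {x w A B : ℝ}
    (hg : ∀ ξ ∈ Set.Icc x (x + 1), HasDerivAt g (g' ξ) ξ)
    (hb : ∀ ξ ∈ Set.Icc x (x + 1), A ≤ w * g' ξ ∧ w * g' ξ ≤ B) :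
    A ≤ w * (g (x + 1) - g x) ∧ w * (g (x + 1) - g x) ≤ B := by
  obtain ⟨ξ, hξ, h⟩ := exists_hasDerivAt_eq_slope g g' (lt_add_one x)
    (fun y hy => (hg y hy).continuousAt.continuousWithinAt)
    (fun y hy => hg y (Set.Ioo_subset_Icc_self hy))
  have := hb ξ (Set.Ioo_subset_Icc_self hξ)
  rw [h] at this
  simpa using this

/-! ### Sums and counts along a sequence with bounded increments -/

/-- A Riemann sum for `∫ dt / (1 + t²)`: since `θ < 1`, the spare factor `e^{-(1-θ)|d|}` beats `1/(1
+ d²)`, so each term is at most a multiple of `R` times an increment of `arctan ∘ d`, and these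
telescope to at most `π`. -/
theorem sum_exp_neg_abs_le {A B C θ : ℝ} (hA : 0 < A) (hC : 0 < C) (hθ : θ < 1) :
    ∃ C' : ℝ, 0 < C' ∧ ∀ (d w : ℕ → ℝ) (R : ℝ), 0 ≤ R → (∀ k, 1 ≤ w k) →
      (∀ k, A ≤ w k * (d (k + 1) - d k) ∧ w k * (d (k + 1) - d k) ≤ B) →
      (∀ k, w k ≤ C * R * Real.exp (θ * |d k|)) →
      ∀ N, ∑ k ∈ Finset.range N, Real.exp (-|d k|) ≤ C' * R := by
  obtain ⟨C₀, hC₀, hexp⟩ := one_add_rpow_le_exp 2 (1 - θ) (by linarith)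
  refine ⟨C * C₀ / A * (2 + 2 * B ^ 2) * Real.pi, by positivity, ?_⟩
  intro d w R hR hw hd hwd N
  have key : ∀ k, Real.exp (-|d k|) ≤
      C * C₀ / A * (2 + 2 * B ^ 2) * R * (Real.arctan (d (k + 1)) - Real.arctan (d k)) := by
    intro k
    obtain ⟨h1, h2⟩ := hd k
    have hwk := hw k
    have hw0 : 0 < w k := by linarith
    have hΔ : 0 < d (k + 1) - d k := by
      by_contra! hneg
      nlinarith [mul_nonneg hw0.le (neg_nonneg.2 hneg)]
    have harc := sub_div_le_arctan_sub (D := B) (sub_pos.1 hΔ).le (by nlinarith)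
    have hpoly : 1 + d k ^ 2 ≤ C₀ * Real.exp ((1 - θ) * |d k|) := by
      refine le_trans ?_ (hexp _ (abs_nonneg (d k)))
      rw [Real.rpow_two]
      nlinarith [sq_abs (d k), abs_nonneg (d k)]
    have hprod : w k * (1 + d k ^ 2) ≤ C * C₀ * R * Real.exp |d k| := by
      calc w k * (1 + d k ^ 2)
          ≤ (C * R * Real.exp (θ * |d k|)) * (C₀ * Real.exp ((1 - θ) * |d k|)) := by
            gcongr
            exact hwd k
        _ = C * C₀ * R * (Real.exp (θ * |d k|) * Real.exp ((1 - θ) * |d k|)) := by ring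
        _ = _ := by rw [← Real.exp_add]; ring_nf
    have hA1 : A * (1 + d k ^ 2) ≤ C * C₀ * R * Real.exp |d k| * (d (k + 1) - d k) := by
      calc A * (1 + d k ^ 2) ≤ w k * (d (k + 1) - d k) * (1 + d k ^ 2) := by gcongr
        _ = w k * (1 + d k ^ 2) * (d (k + 1) - d k) := by ring
        _ ≤ _ := by gcongr
    have hstep : Real.exp (-|d k|) ≤ C * C₀ / A * R * ((d (k + 1) - d k) / (1 + d k ^ 2)) := by
      rw [Real.exp_neg, inv_le_iff_one_le_mul₀ (Real.exp_pos _)]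
      have : C * C₀ / A * R * ((d (k + 1) - d k) / (1 + d k ^ 2)) * Real.exp |d k| =
          (C * C₀ * R * Real.exp |d k| * (d (k + 1) - d k)) / (A * (1 + d k ^ 2)) := by
        field_simp
      rw [this, one_le_div (by positivity)]
      exact hA1
    refine hstep.trans ?_
    calc _ ≤ C * C₀ / A * R *
          ((2 + 2 * B ^ 2) * (Real.arctan (d (k + 1)) - Real.arctan (d k))) := by gcongr
      _ = _ := by ring
  calc _ ≤ ∑ k ∈ Finset.range N, C * C₀ / A * (2 + 2 * B ^ 2) * R *
        (Real.arctan (d (k + 1)) - Real.arctan (d k)) := Finset.sum_le_sum fun k _ => key k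
    _ = C * C₀ / A * (2 + 2 * B ^ 2) * R * (Real.arctan (d N) - Real.arctan (d 0)) := by
        rw [← Finset.mul_sum, Finset.sum_range_sub fun k => Real.arctan (d k)]
    _ ≤ C * C₀ / A * (2 + 2 * B ^ 2) * R * Real.pi := by
        gcongr
        linarith [Real.arctan_lt_pi_div_two (d N), Real.neg_pi_div_two_lt_arctan (d 0)]
    _ = _ := by ring

theorem exists_window_card_ge {A B c R E : ℝ} {d w : ℕ → ℝ} (hA : 0 < A) (hB : 0 < B)
    (hw : ∀ k, 1 ≤ w k)
    (hd : ∀ k, A ≤ w k * (d (k + 1) - d k) ∧ w k * (d (k + 1) - d k) ≤ B)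
    (htop : Tendsto d atTop atTop) (h0 : d 0 < E)
    (hwR : ∀ k, E ≤ d k → d k ≤ E + B + 1 → c * R ≤ w k) (hcR : 0 ≤ c * R) :
    ∃ S : Finset ℕ, (∀ k ∈ S, E ≤ d k ∧ d k ≤ E + B + 1) ∧ c / B * R ≤ S.card := by
  classical
  have hΔ : ∀ k, 0 < d (k + 1) - d k := fun k => by
    have := hw k
    by_contra! hneg
    nlinarith [(hd k).1, mul_nonneg (by linarith : 0 ≤ w k) (neg_nonneg.2 hneg)]
  have hmono : StrictMono d := strictMono_nat_of_lt_succ fun k => sub_pos.1 (hΔ k)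
  have hex : ∀ t, ∃ k, t ≤ d k := fun t => (htop.eventually_ge_atTop t).exists
  -- Steps are at most `B` because `w ≥ 1`, so the first entry past `E` lands below `E + B`. A climb
  -- of at least 1 remains, in steps of at most `B / (c R)`.
  set a := Nat.find (hex E) with ha
  set b := Nat.find (hex (E + B + 1)) with hb
  have haE : E ≤ d a := Nat.find_spec (hex E)
  have hbE : E + B + 1 ≤ d b := Nat.find_spec (hex (E + B + 1))
  have ha0 : a ≠ 0 := fun h => by rw [h] at haE; linarith
  obtain ⟨m, hm⟩ := Nat.exists_eq_succ_of_ne_zero ha0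
  have hdm : d m < E := not_le.1 (Nat.find_min (hex E) (by omega : m < a))
  have hda : d a ≤ E + B := by
    have := (hd m).2
    have h1 := hw m
    rw [hm]
    change d (m + 1) ≤ _
    nlinarith [hΔ m]
  have hab : a ≤ b := (hmono.lt_iff_lt.1 (by linarith : d a < d b)).le
  have hS : ∀ k ∈ Finset.Ico a b, E ≤ d k ∧ d k ≤ E + B + 1 := fun k hk => by
    rw [Finset.mem_Ico] at hk
    exact ⟨haE.trans (hmono.monotone hk.1),
      (not_le.1 (Nat.find_min (hex (E + B + 1)) hk.2)).le⟩
  refine ⟨Finset.Ico a b, hS, ?_⟩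
  have hsum : c * R * (d b - d a) ≤ (Finset.Ico a b).card * B := by
    rw [← Finset.sum_Ico_sub d hab, Finset.mul_sum, ← nsmul_eq_mul]
    refine Finset.sum_le_card_nsmul _ _ _ fun k hk => ?_
    refine le_trans ?_ (hd k).2
    gcongr
    · exact (hΔ k).le
    · exact hwR k (hS k hk).1 (hS k hk).2
  rw [div_mul_eq_mul_div, div_le_iff₀ hB]
  nlinarith

/-! ### Size of a single term -/

/-- With `x = v q`, the term is at most `x e^{-x}`, bounded by `x` when `g ≥ log v` and by `2 / x`
otherwise. -/
theorem mass_mul_one_sub_pow_le {c g q : ℝ} {v : ℕ} (hc : 0 < c) (hv : 0 < v) (hq1 : q ≤ 1)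
    (hq : q = c * Real.exp (-g)) :
    v * (q * (1 - q) ^ v) ≤ max c (2 / c) * Real.exp (-|g - Real.log v|) := by
  have hv' : (0 : ℝ) < v := by exact_mod_cast hv
  have hx : v * q = c * Real.exp (-(g - Real.log v)) := by
    rw [hq, neg_sub, sub_eq_add_neg, Real.exp_add, Real.exp_log hv']; ring
  have hx0 : 0 < v * q := by rw [hx]; positivity
  have h1 : v * (q * (1 - q) ^ v) ≤ v * q * Real.exp (-(v * q)) := by
    rw [← mul_assoc]
    gcongr
    exact mul_one_sub_pow_le hq1 v
  refine h1.trans ?_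
  rcases le_total 0 (g - Real.log v) with h | h
  · rw [abs_of_nonneg h]
    calc v * q * Real.exp (-(v * q)) ≤ v * q * 1 := by
          gcongr
          exact Real.exp_le_one_iff.2 (by linarith)
      _ = c * Real.exp (-(g - Real.log v)) := by rw [mul_one, hx]
      _ ≤ _ := by gcongr; exact le_max_left _ _
  · rw [abs_of_nonpos h, neg_neg]
    calc v * q * Real.exp (-(v * q)) ≤ 2 / (v * q) := mul_exp_neg_le_div hx0
      _ = 2 / c * Real.exp (g - Real.log v) := by rw [hx, Real.exp_neg]; field_simp
      _ ≤ _ := by gcongr; exact le_max_right _ _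

theorem le_mass_mul_one_sub_pow {c g q : ℝ} {v : ℕ} {E F : ℝ} (hc : 0 < c) (hv : 0 < v)
    (hq1 : q ≤ 1) (hq : q = c * Real.exp (-g)) (hE : c * Real.exp (-E) ≤ 1 / 2)
    (h1 : E ≤ g - Real.log v) (h2 : g - Real.log v ≤ F) :
    c * Real.exp (-F) / 2 ≤ v * (q * (1 - q) ^ v) := by
  have hv' : (0 : ℝ) < v := by exact_mod_cast hv
  have hx : v * q = c * Real.exp (-(g - Real.log v)) := by
    rw [hq, neg_sub, sub_eq_add_neg, Real.exp_add, Real.exp_log hv']; ring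
  have hlow : c * Real.exp (-F) ≤ v * q := by rw [hx]; gcongr
  have hup : v * q ≤ 1 / 2 := by rw [hx]; refine le_trans ?_ hE; gcongr
  -- Bernoulli: `(1 - q)^v ≥ 1 - v q ≥ 1/2`.
  have hbern := one_add_mul_le_pow (show -2 ≤ -q by linarith) v
  rw [← sub_eq_add_neg] at hbern
  have : 1 / 2 ≤ (1 - q) ^ v := by linarith
  calc c * Real.exp (-F) / 2 = c * Real.exp (-F) * (1 / 2) := by ring
    _ ≤ v * q * (1 - q) ^ v := mul_le_mul hlow this (by norm_num) (le_trans (by positivity) hlow)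
    _ = _ := by ring

/-! ### The tail index as a series and its general asymptotics -/

theorem IsProbDist.le_one {p : ℕ+ → ℝ} (hp : IsProbDist p) (k : ℕ+) : p k ≤ 1 :=
  le_hasSum hp.2 k fun j _ => hp.1 j

theorem hasSum_tailIndex {p : ℕ+ → ℝ} (hp : IsProbDist p) (v : ℕ) :
    HasSum (fun n : ℕ => (v : ℝ) * (p n.succPNat * (1 - p n.succPNat) ^ v)) (tailIndex p v) := by
  have hs : Summable fun k : ℕ+ => p k * (1 - p k) ^ v := by
    refine Summable.of_nonneg_of_le
      (fun k => mul_nonneg (hp.1 k) (pow_nonneg (sub_nonneg.2 (hp.le_one k)) v))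
      (fun k => ?_) hp.2.summable
    exact mul_le_of_le_one_right (hp.1 k)
      (pow_le_one₀ (sub_nonneg.2 (hp.le_one k)) (by linarith [hp.1 k]))
  exact ((Equiv.pnatEquivNat.symm.hasSum_iff (f := fun k : ℕ+ => p k * (1 - p k) ^ v)).2
    hs.hasSum).mul_left (v : ℝ)

/-- Tail asymptotics of the tail index for `p_k = c e^{-G k}`, where `W` is comparable to
`1 / G'` and, as a function of `G`, to `r`. -/
theorem tailIndex_sameRate {p : ℕ+ → ℝ} (hp : IsProbDist p) {G W r : ℝ → ℝ} {k₀ : ℕ+}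
    {A B C θ : ℝ} (htail : TailProportional p (fun x => Real.exp (-G x)) k₀)
    (hA : 0 < A) (hB : 0 < B) (hC : 0 < C) (hθ : θ < 1)
    (hG : Tendsto G atTop atTop) (hr : Tendsto r atTop atTop)
    (hW : ∀ᶠ x in atTop, 1 ≤ W x)
    (hinc : ∀ᶠ x in atTop, A ≤ W x * (G (x + 1) - G x) ∧ W x * (G (x + 1) - G x) ≤ B)
    (hup : ∀ᶠ x in atTop, ∀ᶠ Y in atTop,
      ∀ y ≥ x, W y ≤ C * r Y * Real.exp (θ * |G y - Y|))
    (hlow : ∀ L > 0, ∃ c > 0, ∀ᶠ x in atTop, ∀ᶠ Y in atTop,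
      ∀ y ≥ x, |G y - Y| ≤ L → c * r Y ≤ W y) :
    Tendsto (tailIndex p) atTop atTop ∧
      SameRate (tailIndex p) (fun v => r (Real.log v)) := by
  obtain ⟨c, hc, hpc⟩ := htail
  obtain ⟨E, hE0, hE⟩ : ∃ E : ℝ, 0 < E ∧ c * Real.exp (-E) ≤ 1 / 2 := by
    have h : Tendsto (fun E : ℝ => c * Real.exp (-E)) atTop (nhds (c * 0)) :=
      (Real.tendsto_exp_neg_atTop_nhds_zero).const_mul c
    rw [mul_zero] at h
    exact ((eventually_gt_atTop 0).and
      (h.eventually (ge_mem_nhds (by norm_num : (0 : ℝ) < 1 / 2)))).exists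
  obtain ⟨c', hc', hlow⟩ := hlow (E + B + 1) (by linarith)
  obtain ⟨X, hX⟩ := eventually_atTop.1 (hW.and (hinc.and (hup.and hlow)))
  -- `K` does not depend on `v`. The first `K` terms are each at most 1, which `r → ∞` absorbs.
  obtain ⟨K, hK⟩ := exists_nat_ge (max X k₀)
  have hKX : X ≤ K := (le_max_left _ _).trans hK
  have hKk : (k₀ : ℕ) ≤ K := by exact_mod_cast (le_max_right _ _).trans hK
  set x : ℕ → ℝ := fun k => (K : ℝ) + k + 1 with hxdef
  have hxK : ∀ k, (K : ℝ) ≤ x k := fun k => by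
    simp only [hxdef]; linarith [Nat.cast_nonneg (α := ℝ) k]
  have hxX : ∀ k, X ≤ x k := fun k => hKX.trans (hxK k)
  have hxs : ∀ k, x (k + 1) = x k + 1 := fun k => by simp only [hxdef]; push_cast; ring
  have hq : ∀ k, p (K + k).succPNat = c * Real.exp (-G (x k)) := fun k => by
    rw [hpc _ (by rw [← PNat.coe_le_coe, Nat.succPNat_coe]; omega)]
    simp [hxdef]
  have hw1 : ∀ k, 1 ≤ W (x k) := fun k => (hX _ (hxX k)).1
  have hd : ∀ (Y : ℝ) k, A ≤ W (x k) * ((G (x (k + 1)) - Y) - (G (x k) - Y)) ∧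
      W (x k) * ((G (x (k + 1)) - Y) - (G (x k) - Y)) ≤ B := fun Y k => by
    rw [sub_sub_sub_cancel_right, hxs]
    exact (hX _ (hxX k)).2.1
  have hlog : Tendsto (fun v : ℕ => Real.log v) atTop atTop :=
    Real.tendsto_log_atTop.comp tendsto_natCast_atTop_atTop
  have hGx : ∀ Y : ℝ, Tendsto (fun k => G (x k) - Y) atTop atTop := fun Y => by
    refine tendsto_atTop_add_const_right _ (-Y) (hG.comp ?_)
    exact tendsto_atTop_add_const_right _ 1
      (tendsto_atTop_add_const_left _ _ tendsto_natCast_atTop_atTop)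
  have hq1 : ∀ n : ℕ, p n.succPNat ≤ 1 := fun n => hp.le_one _
  have hf0 : ∀ (v n : ℕ), 0 ≤ (v : ℝ) * (p n.succPNat * (1 - p n.succPNat) ^ v) := fun v n =>
    mul_nonneg v.cast_nonneg (mul_nonneg (hp.1 _) (pow_nonneg (sub_nonneg.2 (hq1 n)) v))
  have hf1 : ∀ (v n : ℕ), (v : ℝ) * (p n.succPNat * (1 - p n.succPNat) ^ v) ≤ 1 := fun v n => by
    refine le_trans ?_ (mul_exp_neg_le_one (x := v * p n.succPNat))
    rw [← mul_assoc]
    exact mul_le_mul_of_nonneg_left (mul_one_sub_pow_le (hq1 n) v)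
      (mul_nonneg v.cast_nonneg (hp.1 _))
  obtain ⟨C', hC', hsum⟩ := sum_exp_neg_abs_le (B := B) hA hC hθ
  have hupper : ∀ᶠ v : ℕ in atTop,
      tailIndex p v ≤ (K + max c (2 / c) * C') * r (Real.log v) := by
    filter_upwards [hlog.eventually (hX _ hKX).2.2.1,
      (hr.comp hlog).eventually_ge_atTop 1, eventually_gt_atTop 0] with v hv hr1 hv0
    simp only [Function.comp_apply] at hr1
    rw [← (hasSum_tailIndex hp v).tsum_eq]
    refine Real.tsum_le_of_sum_range_le (hf0 v) fun N => ?_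
    calc _ ≤ ∑ n ∈ Finset.range (K + N), (v : ℝ) * (p n.succPNat * (1 - p n.succPNat) ^ v) :=
          Finset.sum_le_sum_of_subset_of_nonneg (Finset.range_mono (by omega))
            fun n _ _ => hf0 v n
      _ ≤ ∑ n ∈ Finset.range K, 1 +
          ∑ k ∈ Finset.range N, max c (2 / c) * Real.exp (-|G (x k) - Real.log v|) := by
          rw [Finset.sum_range_add]
          exact add_le_add (Finset.sum_le_sum fun n _ => hf1 v n)
            (Finset.sum_le_sum fun k _ => mass_mul_one_sub_pow_le hc hv0 (hq1 _) (hq k))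
      _ ≤ K * r (Real.log v) + max c (2 / c) * (C' * r (Real.log v)) := by
          rw [← Finset.mul_sum]
          refine add_le_add ?_ ?_
          · simpa using le_mul_of_one_le_right (Nat.cast_nonneg (α := ℝ) K) hr1
          · refine mul_le_mul_of_nonneg_left ?_ (le_max_of_le_left hc.le)
            exact hsum (fun k => G (x k) - Real.log v) (fun k => W (x k)) _ (by linarith)
              hw1 (hd _) (fun k => hv _ (hxK k)) N
      _ = _ := by ring
  have hlower : ∀ᶠ v : ℕ in atTop,
      c * Real.exp (-(E + B + 1)) / 2 * (c' / B) * r (Real.log v) ≤ tailIndex p v := by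
    filter_upwards [hlog.eventually (hX _ hKX).2.2.2, (hr.comp hlog).eventually_ge_atTop 1,
      eventually_gt_atTop 0, hlog.eventually_gt_atTop (G (x 0) - E)] with v hv hr1 hv0 hG0
    simp only [Function.comp_apply] at hr1
    obtain ⟨S, hS, hcard⟩ := exists_window_card_ge (E := E) (c := c') (R := r (Real.log v))
      (d := fun k => G (x k) - Real.log v) (w := fun k => W (x k)) hA hB hw1 (hd _) (hGx _)
      (by linarith) (fun k h1 h2 => hv _ (hxK k) (by rw [abs_of_nonneg (by linarith)]; exact h2))
      (mul_nonneg hc'.le (by linarith))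
    have hsub := sum_le_hasSum (S.map (addLeftEmbedding K)) (fun n _ => hf0 v n)
      (hasSum_tailIndex hp v)
    refine le_trans ?_ hsub
    rw [Finset.sum_map]
    refine le_trans ?_ (Finset.card_nsmul_le_sum S _ (c * Real.exp (-(E + B + 1)) / 2)
      fun k hk => le_mass_mul_one_sub_pow hc hv0 (hq1 _) (hq k) hE (hS k hk).1 (hS k hk).2)
    rw [nsmul_eq_mul, mul_assoc, mul_comm (S.card : ℝ)]
    gcongr
  have hpos : 0 < c * Real.exp (-(E + B + 1)) / 2 * (c' / B) := by positivity
  exact ⟨tendsto_atTop_mono' _ hlower ((hr.comp hlog).const_mul_atTop hpos),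
    _, _, hpos, by positivity, hlower.and hupper⟩

/-! ### The three tail families -/

theorem le_mul_one_add_abs_sub {y Y : ℝ} (hY : 1 ≤ Y) : y ≤ Y * (1 + |y - Y|) := by
  nlinarith [le_abs_self (y - Y), mul_nonneg (sub_nonneg.2 hY) (abs_nonneg (y - Y))]

theorem power_tail_sameRate {p : ℕ+ → ℝ} (hp : IsProbDist p) {lam : ℝ} (hlam : 1 < lam)
    (h : HasPowerTail p lam) :
    Tendsto (tailIndex p) atTop atTop ∧
      SameRate (tailIndex p) (fun v => (v : ℝ) ^ (1 / lam)) := by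
  obtain ⟨k₀, c, hc, hpc⟩ := h
  have hl0 : 0 < lam := by linarith
  have htail : TailProportional p (fun x => Real.exp (-(lam * Real.log x))) k₀ := by
    refine ⟨c, hc, fun k hk => ?_⟩
    have hk0 : (0 : ℝ) < (k : ℕ) := by exact_mod_cast k.pos
    simp only [hpc k hk, Real.exp_neg, mul_comm lam, ← Real.rpow_def_of_pos hk0, one_div]
  have hW : ∀ {x : ℝ}, 0 < x → ∀ Y : ℝ,
      x = Real.exp (Y / lam) * Real.exp (1 / lam * (lam * Real.log x - Y)) := by
    intro x hx Y
    rw [← Real.exp_add]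
    conv_lhs => rw [← Real.exp_log hx]
    congr 1
    field_simp
    ring
  -- Here `W` is exactly `r(Y) e^{(G - Y)/λ}`, so `θ = 1/λ`, and `θ < 1` is the condition `λ > 1`.
  obtain ⟨h1, c₁, c₂, hc₁, hc₂, h2⟩ := tailIndex_sameRate (W := fun x => x)
    (r := fun Y => Real.exp (Y / lam)) (A := lam / 2) (B := lam) (C := 1) (θ := 1 / lam) hp htail
    (by positivity) hl0 one_pos (by rw [div_lt_one hl0]; exact hlam)
    (Real.tendsto_log_atTop.const_mul_atTop hl0)
    (Real.tendsto_exp_atTop.comp (tendsto_id.atTop_div_const hl0))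
    (eventually_ge_atTop 1)
    (by
      filter_upwards [eventually_ge_atTop 1] with x hx
      refine increment_bounds (g := fun x => lam * Real.log x) (g' := fun ξ => lam * ξ⁻¹)
        (fun ξ hξ => (Real.hasDerivAt_log (by linarith [hξ.1])).const_mul lam) fun ξ hξ => ?_
      have hξ0 : 0 < ξ := by linarith [hξ.1]
      rw [← mul_assoc, ← div_eq_mul_inv, div_le_div_iff₀ two_pos hξ0, div_le_iff₀ hξ0]
      constructor <;> nlinarith [hξ.1, hξ.2])
    (by
      filter_upwards [eventually_gt_atTop 0] with x hx
      refine Eventually.of_forall fun Y y hy => ?_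
      conv_lhs => rw [hW (hx.trans_le hy) Y]
      rw [one_mul]
      gcongr
      exact le_abs_self _)
    (fun L hL => ⟨Real.exp (-(1 / lam * L)), Real.exp_pos _, by
      filter_upwards [eventually_gt_atTop 0] with x hx
      refine Eventually.of_forall fun Y y hy hL => ?_
      conv_rhs => rw [hW (hx.trans_le hy) Y, mul_comm]
      rw [← mul_neg]
      gcongr
      exact (abs_le.1 hL).1⟩)
  refine ⟨h1, c₁, c₂, hc₁, hc₂, ?_⟩
  filter_upwards [h2, eventually_gt_atTop 0] with v hv hv0
  rwa [Real.rpow_def_of_pos (by exact_mod_cast hv0), mul_one_div]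

theorem subexp_tail_sameRate {p : ℕ+ → ℝ} (hp : IsProbDist p) {lam α : ℝ} (hlam : 0 < lam)
    (hα : 0 < α) (hα1 : α < 1) (h : HasSubexpTail p lam α) :
    Tendsto (tailIndex p) atTop atTop ∧
      SameRate (tailIndex p) (fun v => Real.log (v : ℝ) ^ (1 / α - 1)) := by
  obtain ⟨k₀, htail⟩ := h
  set s := 1 / α - 1 with hs
  have hs0 : 0 < s := by rw [hs, sub_pos, lt_div_iff₀ hα]; linarith
  obtain ⟨C₀, hC₀, hexp⟩ := one_add_rpow_le_exp s (1 / 2) (by norm_num)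
  -- `W` is a constant times `G^s`, because `α s = 1 - α`.
  have hW : ∀ {x : ℝ}, 0 < x → x ^ (1 - α) = (lam⁻¹) ^ s * (lam * x ^ α) ^ s := by
    intro x hx
    rw [← Real.mul_rpow (by positivity) (by positivity), inv_mul_cancel_left₀ hlam.ne',
      ← Real.rpow_mul hx.le]
    congr 1
    rw [hs]
    field_simp
  refine tailIndex_sameRate (W := fun x => x ^ (1 - α)) (r := fun Y => Y ^ s)
    (A := lam * α * (1 / 2)) (B := lam * α) (C := (lam⁻¹) ^ s * C₀) (θ := 1 / 2) hp htail
    (by positivity) (by positivity) (by positivity) (by norm_num)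
    ((tendsto_rpow_atTop hα).const_mul_atTop hlam) (tendsto_rpow_atTop hs0) ?_ ?_ ?_ ?_
  · filter_upwards [eventually_ge_atTop 1] with x hx
    exact Real.one_le_rpow hx (by linarith)
  · filter_upwards [eventually_ge_atTop 1] with x hx
    refine increment_bounds (g := fun x => lam * x ^ α)
      (g' := fun ξ => lam * (α * ξ ^ (α - 1)))
      (fun ξ hξ => (Real.hasDerivAt_rpow_const (Or.inl (by linarith [hξ.1]))).const_mul lam)
      fun ξ hξ => ?_
    have hx0 : 0 < x := by linarith
    have hξ0 : 0 < ξ := by linarith [hξ.1]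
    have heq : x ^ (1 - α) * (lam * (α * ξ ^ (α - 1))) = lam * α * (x / ξ) ^ (1 - α) := by
      rw [Real.div_rpow hx0.le hξ0.le, show α - 1 = -(1 - α) by ring, Real.rpow_neg hξ0.le]
      ring
    have hle : x / ξ ≤ 1 := (div_le_one hξ0).2 hξ.1
    have hge : 1 / 2 ≤ x / ξ := by
      rw [div_le_div_iff₀ two_pos hξ0]; linarith [hξ.2]
    rw [heq]
    constructor
    · refine mul_le_mul_of_nonneg_left (hge.trans ?_) (by positivity)
      exact Real.self_le_rpow_of_le_one (by positivity) hle (by linarith)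
    · exact mul_le_of_le_one_right (by positivity)
        (Real.rpow_le_one (by positivity) hle (by linarith))
  · filter_upwards [eventually_gt_atTop 0] with x hx
    filter_upwards [eventually_ge_atTop 1] with Y hY y hy
    have hy0 : 0 < y := hx.trans_le hy
    have hY0 : 0 < Y := by linarith
    rw [hW hy0]
    calc _ ≤ (lam⁻¹) ^ s * (Y * (1 + |lam * y ^ α - Y|)) ^ s := by
          have := le_mul_one_add_abs_sub (y := lam * y ^ α) hY
          gcongr (lam⁻¹) ^ s * ?_ ^ s
      _ = (lam⁻¹) ^ s * (Y ^ s * (1 + |lam * y ^ α - Y|) ^ s) := by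
          rw [Real.mul_rpow hY0.le (by positivity)]
      _ ≤ (lam⁻¹) ^ s * (Y ^ s * (C₀ * Real.exp (1 / 2 * |lam * y ^ α - Y|))) := by
          gcongr
          exact hexp _ (abs_nonneg _)
      _ = _ := by ring
  · intro L hL
    refine ⟨(lam⁻¹) ^ s * (1 / 2) ^ s, by positivity, ?_⟩
    filter_upwards [eventually_gt_atTop 0] with x hx
    filter_upwards [eventually_ge_atTop (2 * L)] with Y hY y hy hyL
    have hY0 : 0 < Y := by linarith
    rw [hW (hx.trans_le hy), mul_assoc, ← Real.mul_rpow (by norm_num) hY0.le]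
    have : 1 / 2 * Y ≤ lam * y ^ α := by linarith [(abs_le.1 hyL).1]
    gcongr (lam⁻¹) ^ s * ?_ ^ s

theorem hasDerivAt_div_log_rpow {lam β x : ℝ} (hx : 1 < x) :
    HasDerivAt (fun x => lam * x / Real.log x ^ β)
      (lam * (Real.log x ^ β)⁻¹ * (1 - β / Real.log x)) x := by
  have hl : 0 < Real.log x := Real.log_pos hx
  have hx0 : x ≠ 0 := by linarith
  have hd := ((hasDerivAt_id x).const_mul lam).div
    ((Real.hasDerivAt_log hx0).rpow_const (p := β) (Or.inl hl.ne'))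
    (Real.rpow_pos_of_pos hl β).ne'
  refine hd.congr_deriv ?_
  have := (Real.rpow_pos_of_pos hl β).ne'
  rw [Real.rpow_sub_one hl.ne']
  simp only [id]
  field_simp

/-- This crude bound yields both `G → ∞` and `log x ≤ 2 log G(x)`. -/
theorem eventually_sqrt_le_div_log_rpow {lam β : ℝ} (hlam : 0 < lam) :
    ∀ᶠ x in atTop, x ^ (1 / 2 : ℝ) ≤ lam * x / Real.log x ^ β := by
  have h := (isLittleO_log_rpow_rpow_atTop β (by norm_num : (0 : ℝ) < 1 / 2)).bound hlam
  filter_upwards [h, eventually_gt_atTop 1] with x hx hx1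
  have hx0 : 0 < x := by linarith
  have hl : 0 < Real.log x ^ β := Real.rpow_pos_of_pos (Real.log_pos hx1) β
  have hs : 0 < x ^ (1 / 2 : ℝ) := Real.rpow_pos_of_pos hx0 _
  rw [Real.norm_of_nonneg hl.le, Real.norm_of_nonneg hs.le] at hx
  rw [le_div_iff₀ hl]
  have hsq : x ^ (1 / 2 : ℝ) * x ^ (1 / 2 : ℝ) = x := by
    rw [← Real.rpow_add hx0]; norm_num
  nlinarith

theorem nearExp_tail_sameRate {p : ℕ+ → ℝ} (hp : IsProbDist p) {lam β : ℝ} (hlam : 0 < lam)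
    (hβ : 0 < β) (h : HasNearExpTail p lam β) :
    Tendsto (tailIndex p) atTop atTop ∧
      SameRate (tailIndex p) (fun v => Real.log (Real.log (v : ℝ)) ^ β) := by
  obtain ⟨k₀, -, htail⟩ := h
  obtain ⟨C₀, hC₀, hexp⟩ := one_add_rpow_le_exp β (1 / 2) (by norm_num)
  have hsqrt := eventually_sqrt_le_div_log_rpow (β := β) hlam
  obtain ⟨X, hX⟩ := eventually_atTop.1 (hsqrt.and ((eventually_ge_atTop lam).and
    (eventually_ge_atTop (Real.exp 1))))
  set G : ℝ → ℝ := fun x => lam * x / Real.log x ^ β with hGdef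
  have hlog1 : ∀ {x : ℝ}, Real.exp 1 ≤ x → 1 ≤ Real.log x := fun {x} hx =>
    (Real.le_log_iff_exp_le (by linarith [Real.exp_pos 1])).2 hx
  -- From `√y ≤ G(y) ≤ y²`: `log y` and `log G(y)` are comparable, so no inversion of `G` is needed.
  have hlogG : ∀ y, X ≤ y → 0 < G y ∧ Real.log y ≤ 2 * Real.log (G y) ∧
      Real.log (G y) ≤ 2 * Real.log y := by
    intro y hy
    obtain ⟨h1, h2, h3⟩ := hX y hy
    have hy0 : 0 < y := by linarith [Real.exp_pos 1]
    have hG0 : 0 < G y := (Real.rpow_pos_of_pos hy0 _).trans_le h1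
    refine ⟨hG0, ?_, ?_⟩
    · have := Real.log_le_log (Real.rpow_pos_of_pos hy0 _) h1
      rw [Real.log_rpow hy0] at this
      linarith
    · have hle : G y ≤ y ^ 2 := by
        rw [hGdef]
        refine (div_le_self (by positivity) (Real.one_le_rpow (hlog1 h3) hβ.le)).trans ?_
        rw [sq]
        gcongr
      have := Real.log_le_log hG0 hle
      rwa [Real.log_pow] at this
  refine tailIndex_sameRate (G := G) (W := fun x => Real.log x ^ β)
    (r := fun Y => Real.log Y ^ β)
    (A := lam * (1 / 2) ^ β * (1 / 2)) (B := lam) (C := 2 ^ β * C₀) (θ := 1 / 2) hp htail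
    (by positivity) (by positivity) (by positivity) (by norm_num)
    (tendsto_atTop_mono' _ hsqrt (tendsto_rpow_atTop (by norm_num)))
    ((tendsto_rpow_atTop hβ).comp Real.tendsto_log_atTop) ?_ ?_ ?_ ?_
  · filter_upwards [eventually_ge_atTop (Real.exp 1)] with x hx
    exact Real.one_le_rpow (hlog1 hx) hβ.le
  · filter_upwards [eventually_ge_atTop 2,
      Real.tendsto_log_atTop.eventually_ge_atTop (2 * β)] with x hx2 hxβ
    refine increment_bounds (g := G)
      (g' := fun ξ => lam * (Real.log ξ ^ β)⁻¹ * (1 - β / Real.log ξ))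
      (fun ξ hξ => hasDerivAt_div_log_rpow (by linarith [hξ.1])) fun ξ hξ => ?_
    have hlx : 0 < Real.log x := Real.log_pos (by linarith)
    have hlξ : Real.log x ≤ Real.log ξ := Real.log_le_log (by linarith) hξ.1
    have hlξ0 : 0 < Real.log ξ := hlx.trans_le hlξ
    have hlξ2 : Real.log ξ ≤ 2 * Real.log x := by
      have : Real.log ξ ≤ Real.log (x ^ 2) :=
        Real.log_le_log (by linarith [hξ.1]) (by nlinarith [hξ.2])
      rwa [Real.log_pow] at this
    have heq : Real.log x ^ β * (lam * (Real.log ξ ^ β)⁻¹ * (1 - β / Real.log ξ)) =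
        lam * (Real.log x / Real.log ξ) ^ β * (1 - β / Real.log ξ) := by
      rw [Real.div_rpow hlx.le hlξ0.le]
      ring
    have hle : Real.log x / Real.log ξ ≤ 1 := (div_le_one hlξ0).2 hlξ
    have hge : 1 / 2 ≤ Real.log x / Real.log ξ := by
      rw [div_le_div_iff₀ two_pos hlξ0]; linarith
    have hb : β / Real.log ξ ≤ 1 / 2 := by
      rw [div_le_div_iff₀ hlξ0 two_pos]; linarith
    have hb0 : 0 ≤ β / Real.log ξ := by positivity
    rw [heq]
    constructor
    · gcongr
      linarith
    · have h1 : (Real.log x / Real.log ξ) ^ β ≤ 1 := Real.rpow_le_one (by positivity) hle hβ.le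
      calc _ ≤ lam * 1 * 1 := by
            gcongr
            · linarith
            · linarith
        _ = lam := by ring
  · filter_upwards [eventually_ge_atTop X] with x hx
    filter_upwards [eventually_ge_atTop (Real.exp 1)] with Y hY y hy
    obtain ⟨hG0, hl, -⟩ := hlogG y (hx.trans hy)
    have hY0 : 0 < Y := by linarith [Real.exp_pos 1]
    have hlY := hlog1 hY
    have hly : 0 ≤ Real.log y := by
      linarith [hlog1 (hX y (hx.trans hy)).2.2]
    have habs := abs_nonneg (G y - Y)
    -- `log Y ≥ 1` turns the additive error `|G y - Y|` into a factor.
    have hlogle : Real.log y ≤ 2 * (Real.log Y * (1 + |G y - Y|)) := by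
      have h1 : Real.log (G y) ≤ Real.log (Y * (1 + |G y - Y|)) :=
        Real.log_le_log hG0
          (le_mul_one_add_abs_sub (by linarith [Real.add_one_le_exp (1 : ℝ)]))
      rw [Real.log_mul hY0.ne' (by positivity)] at h1
      have h2 := Real.log_le_sub_one_of_pos (show 0 < 1 + |G y - Y| by positivity)
      nlinarith
    calc Real.log y ^ β ≤ (2 * (Real.log Y * (1 + |G y - Y|))) ^ β := by gcongr
      _ = 2 ^ β * (Real.log Y ^ β * (1 + |G y - Y|) ^ β) := by
          rw [Real.mul_rpow (by norm_num) (by positivity),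
            Real.mul_rpow (by positivity) (by positivity)]
      _ ≤ 2 ^ β * (Real.log Y ^ β * (C₀ * Real.exp (1 / 2 * |G y - Y|))) := by
          gcongr
          exact hexp _ habs
      _ = _ := by ring
  · intro L hL
    -- `1/4` collects two factors 2: `log Y ≤ 2 log G(y)`, from `Y ≤ (Y/2)² ≤ G(y)²` for `Y ≥ 4`,
    -- and `log G(y) ≤ 2 log y`.
    refine ⟨(1 / 4) ^ β, by positivity, ?_⟩
    filter_upwards [eventually_ge_atTop X] with x hx
    filter_upwards [eventually_ge_atTop (2 * L), eventually_ge_atTop 4] with Y hYL hY4 y hy hyL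
    obtain ⟨-, -, hl⟩ := hlogG y (hx.trans hy)
    have hlY : 0 ≤ Real.log Y := Real.log_nonneg (by linarith)
    rw [← Real.mul_rpow (by norm_num) hlY]
    have h1 : Real.log Y ≤ 2 * Real.log (G y) := by
      have hhalf : Y / 2 ≤ G y := by linarith [(abs_le.1 hyL).1]
      have : Real.log Y ≤ Real.log (G y ^ 2) :=
        Real.log_le_log (by linarith) (by nlinarith)
      rwa [Real.log_pow] at this
    gcongr
    linarith

theorem proposition2 (p : ℕ+ → ℝ) (hp : IsProbDist p) :
    (∀ lam : ℝ, 1 < lam → HasPowerTail p lam →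
      Tendsto (tailIndex p) atTop atTop ∧
      SameRate (tailIndex p) (fun v => (v : ℝ) ^ (1 / lam))) ∧
    (∀ lam α : ℝ, 0 < lam → 0 < α → α < 1 → HasSubexpTail p lam α →
      Tendsto (tailIndex p) atTop atTop ∧
      SameRate (tailIndex p) (fun v => Real.log (v : ℝ) ^ (1 / α - 1))) ∧
    (∀ lam β : ℝ, 0 < lam → 0 < β → HasNearExpTail p lam β →
      Tendsto (tailIndex p) atTop atTop ∧
      SameRate (tailIndex p) (fun v => Real.log (Real.log (v : ℝ)) ^ β)) :=
  ⟨fun _ hlam h => power_tail_sameRate hp hlam h,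
    fun _ _ hlam hα hα1 h => subexp_tail_sameRate hp hlam hα hα1 h,
    fun _ _ hlam hβ h => nearExp_tail_sameRate hp hlam hβ h⟩
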